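/- Theorem (even and odd flow polynomials). A graph $(V,E)$ has a finite vertex set $V$ and a finite edge set $E$; each edge has exactly two ends, each end being connected to one vertex or to none, and at least one of the two ends of each edge is connected to a vertex (so loops, multiple edges, and outer-edges with only one attached end are allowed). A signed graph $\Sigma$ is a graph with a sign $\sigma(e)\in\{1,-1\}$ for each edge $e$. An orientation of an edge puts an arrow on each of its two ends, the two arrows having the same direction along the edge if $\sigma(e)=1$ and opposite directions if $\sigma(e)=-1$; each edge $e$ thus has two mutually opposite orientations, $\vec e$ and $\vec e^{\,-1}$. For a vertex $v$ let $[v,\vec e\,]$ be the number of ends of $e$ connected to $v$ whose arrow points to $v$, minus the number of ends of $e$ connected to $v$ whose arrow points away from $v$. A flow of $\Sigma$ over an abelian group $\mathbb A$ is a function $f$ on oriented edges with $f(\vec e^{\,-1})=-f(\vec e\,)$ and $\sum_{e\in E}[v,\vec e\,]f(\vec e\,)=0$ for every $v\in V$; it is nowhere-zero if $f(\vec e\,)\neq0$ for every $e$. Let $\mathrm F_{\rm nz}(\Sigma,\mathbb A)$ be the set of nowhere-zero flows, let $\mathrm{Tor}_2(\mathbb A)=\{a\in\mathbb A:2a=0\}$,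 and let $\mathbb Z_n=\mathbb Z/n\mathbb Z$. Let $\Sigma$ be a signed graph with $E\neq\varnothing$, and let $R$ be an integral domain of characteristic $0$ (for example $\mathbb Z$ or $\mathbb R$), in which all polynomials below have their coefficients. There is a unique bivariate polynomial $\varphi(\Sigma;t,x)$, the flow polynomial of $\Sigma$, such that $|\mathrm F_{\rm nz}(\Sigma,\mathbb A)|=\varphi(\Sigma;|\mathrm{Tor}_2(\mathbb A)|,|\mathbb A|)$ for all finite abelian groups $\mathbb A$. Moreover, there are unique polynomials $\varphi_{\rm even}(\Sigma,x)$ and $\varphi_{\rm odd}(\Sigma,x)$ such that for all integers $n\ge2$, $$\varphi_{\rm even}(\Sigma,n)=|\mathrm F_{\rm nz}(\Sigma,\mathbb Z_n)|\ \text{ if $n$ is even},\qquad \varphi_{\rm odd}(\Sigma,n)=|\mathrm F_{\rm nz}(\Sigma,\mathbb Z_n)|\ \text{ if $n$ is odd},$$ and they are specializations of the flow polynomial: $\varphi_{\rm even}(\Sigma,x)=\varphi(\Sigma;2,x)$ and $\varphi_{\rm odd}(\Sigma,x)=\varphi(\Sigma;1,x)$. -/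

import Mathlib

open Polynomial
open scoped Polynomial.Bivariate

/-- A signed graph with vertex set `V` and edge set `E`.  Each edge has exactly two ends (indexed
by `Fin 2`); each end is connected to one vertex (`some v`) or to none (`none`), and at least one of
the two ends is connected to a vertex.  Thus loops, multiple edges, and outer-edges (edges with
exactly one end connected to a vertex) are allowed.  Each edge carries a sign in `ℤˣ = {1, -1}`. -/
structure SignedGraph (V E : Type*) where
  ends : E → Fin 2 → Option V
  attached : ∀ e, ∃ i v, ends e i = some v
  sign : E → ℤˣ

namespace SignedGraph

variable {V E : Type*}

/-- An arc (oriented edge): an edge together with two arrows, one at each of its ends.  The arrow at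
an end is recorded as `1` if it points outwards along the edge into that end (hence to the vertex
there, if there is one), and as `-1` if it points from that end into the edge.  The two arrows have
the same direction along the edge (so the recorded values are opposite) if the edge is positive, and
opposite directions (so the recorded values agree) if the edge is negative. -/
@[ext]
structure Arc (S : SignedGraph V E) where
  edge : E
  arrow : Fin 2 → ℤˣ
  compat : arrow 0 * arrow 1 = -S.sign edge

namespace Arc

variable {S : SignedGraph V E}

/-- The opposite arc. -/
def reverse (a : S.Arc) : S.Arc where
  edge := a.edge
  arrow := fun i => -a.arrow i
  compat := by simpa using a.compat

instance [Finite E] : Finite S.Arc :=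
  Finite.of_injective (fun a : S.Arc => (a.edge, a.arrow)) fun _ _ h =>
    Arc.ext (congrArg Prod.fst h) (congrArg Prod.snd h)

/-- An edge has exactly two orientations, which are opposite to each other. -/
theorem eq_or_eq_reverse (a b : S.Arc) (h : a.edge = b.edge) : a = b ∨ a = b.reverse := by
  have key : ∀ s t x y z : ℤˣ, s * t = -z → x * y = -z →
      (s = x ∧ t = y) ∨ (s = -x ∧ t = -y) := by decide
  rcases key _ _ _ _ _ a.compat (h ▸ b.compat) with ⟨h0, h1⟩ | ⟨h0, h1⟩
  · left
    exact Arc.ext h (funext fun i => by fin_cases i <;> assumption)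
  · right
    exact Arc.ext h (funext fun i => by fin_cases i <;> assumption)

end Arc

variable (S : SignedGraph V E)

/-- The selected arc of an edge used to write down sums over edges (the choice is immaterial, see
`boundary_apply`). -/
def refArc (e : E) : S.Arc where
  edge := e
  arrow := ![1, -S.sign e]
  compat := by simp

open Classical in
/-- The incidence number `[v, a]` of a vertex and an arc: the sum of the arrow values over the ends
of the arc that are connected to `v`.  So it is `±1` for a non-loop arc pointing to / from `v`, `±2`
for a negative loop at `v` pointing to / from `v`, and `0` for a positive loop and for arcs not at
`v`. -/
noncomputable def incidence (v : V) (a : S.Arc) : ℤ :=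
  ∑ i : Fin 2, if S.ends a.edge i = some v then (a.arrow i : ℤ) else 0

theorem incidence_reverse (v : V) (a : S.Arc) :
    S.incidence v a.reverse = -S.incidence v a := by
  classical
  unfold incidence
  rw [← Finset.sum_neg_distrib]
  refine Finset.sum_congr rfl fun i _ => ?_
  by_cases h : S.ends a.edge i = some v <;> simp [Arc.reverse, h]

/-- The group of `1`-chains over `A`: functions on arcs that are odd under reversal. -/
def chainGroup (A : Type*) [AddCommGroup A] : AddSubgroup (S.Arc → A) where
  carrier := {c | ∀ a, c a.reverse = -c a}
  add_mem' := by
    intro c d hc hd a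
    simp only [Pi.add_apply, hc a, hd a]
    abel
  zero_mem' := by intro a; simp
  neg_mem' := by
    intro c hc a
    simp only [Pi.neg_apply, hc a]

/-- The boundary operator `∂` from `1`-chains to `0`-chains,
`(∂ c)(v) = ∑ e, [v, e] c(e)`, where each edge is taken with one (arbitrary) orientation. -/
noncomputable def boundary [Fintype E] (A : Type*) [AddCommGroup A] :
    S.chainGroup A →+ (V → A) where
  toFun c := fun v => ∑ e, S.incidence v (S.refArc e) • c.1 (S.refArc e)
  map_zero' := by ext v; simp
  map_add' := by intro c d; ext v; simp [Finset.sum_add_distrib]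

/-- The boundary does not depend on the orientation of the edges used to compute it. -/
theorem boundary_apply [Fintype E] {A : Type*} [AddCommGroup A] (c : S.chainGroup A) (v : V)
    (ω : E → S.Arc) (hω : ∀ e, (ω e).edge = e) :
    S.boundary A c v = ∑ e, S.incidence v (ω e) • c.1 (ω e) := by
  refine Finset.sum_congr rfl fun e _ => ?_
  rcases (S.refArc e).eq_or_eq_reverse (ω e) (hω e).symm with h | h
  · rw [h]
  · rw [h, incidence_reverse, c.2 (ω e), smul_neg, neg_smul, neg_neg]

/-- The flow group: the kernel of the boundary operator. -/
noncomputable def flowGroup [Fintype E] (A : Type*) [AddCommGroup A] :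
    AddSubgroup (S.chainGroup A) :=
  (S.boundary A).ker

/-- The set of nowhere-zero flows over `A`. -/
def nowhereZeroFlows [Fintype E] (A : Type*) [AddCommGroup A] : Set (S.chainGroup A) :=
  {f | f ∈ S.flowGroup A ∧ ∀ a : S.Arc, f.1 a ≠ 0}

/-- The number of nowhere-zero flows over `A` (used for finite `A`). -/
noncomputable def numNowhereZeroFlows [Fintype E] (A : Type*) [AddCommGroup A] : ℕ :=
  Nat.card (S.nowhereZeroFlows A)

/-- A bivariate polynomial `φ(t, x)` is a flow polynomial of `S` if for every finite abelian group
`A` the number of nowhere-zero flows over `A` is `φ(|Tor₂ A|, |A|)`, where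
`Tor₂ A = {a ∈ A : 2a = 0}`.  The bivariate polynomial is an element of `R[X][Y]`, the outer
variable `Y` being `t` and the inner variable `X` being `x`. -/
def IsFlowPolynomial [Fintype E] {R : Type*} [CommRing R] (φ : R[X][Y]) : Prop :=
  ∀ (A : Type) [AddCommGroup A] [Finite A],
    (S.numNowhereZeroFlows A : R) =
      φ.evalEval (Nat.card A : R) (Nat.card {a : A // 2 • a = 0} : R)

/-- `p(n)` is the number of nowhere-zero `ℤ/nℤ`-flows for all even `n ≥ 2`. -/
def CountsEvenFlows [Fintype E] {R : Type*} [CommRing R] (p : R[X]) : Prop :=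
  ∀ n : ℕ, 2 ≤ n → Even n → p.eval (n : R) = (S.numNowhereZeroFlows (ZMod n) : R)

/-- `p(n)` is the number of nowhere-zero `ℤ/nℤ`-flows for all odd `n ≥ 2`. -/
def CountsOddFlows [Fintype E] {R : Type*} [CommRing R] (p : R[X]) : Prop :=
  ∀ n : ℕ, 2 ≤ n → Odd n → p.eval (n : R) = (S.numNowhereZeroFlows (ZMod n) : R)

end SignedGraph

/-! By inclusion–exclusion over the set `t` of edges on which a flow must vanish, it suffices to
count all solutions of the incidence system without the columns in `t`. Columns of an incidence
matrix have `ℓ¹`-norm at most `2`, and elimination preserves this bound, so only pivots `±1` and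
`±2` occur. A pivot `±2` splits off a factor `|Tor₂ A|` and each surviving free variable gives a
factor `|A|` (`countsAreMonomial`), so every count is a monomial in these two numbers. Uniqueness
tests on the groups `(ℤ/2)^k × ℤ/(2m+1)`; the specializations hold because `|Tor₂ (ℤ/n)| = gcd(n,
2)`. -/

/-! ### Counting solutions of integer linear systems over finite abelian groups. -/

section IntegerMatrices

/-- The solutions over `A` of the homogeneous linear system with integer coefficients `M`. -/
def integerSystemSolutions {V E : Type*} [Fintype E] (M : V → E → ℤ) (A : Type*)
    [AddCommGroup A] : Set (E → A) :=
  {x | ∀ v, ∑ e, M v e • x e = 0}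

theorem Fintype.sum_eq_add_sum_subtype_ne_of_decidable {E A : Type*} [Fintype E] [DecidableEq E]
    [AddCommMonoid A] (e : E) (f : E → A) :
    ∑ i, f i = f e + ∑ i : {i // i ≠ e}, f i := by
  rw [← Finset.add_sum_erase _ _ (Finset.mem_univ e)]
  congr 1
  exact Finset.sum_subtype _ (by simp) _

section Pivot

variable {V E : Type*} [Fintype E] [DecidableEq E]

/-- The matrix obtained by eliminating the column `e` by means of the row `none`. -/
def eliminate (M : Option V → E → ℤ) (e : E) (ε : ℤ) (c : {i // i ≠ e} → ℤ) (w : V)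
    (i : {i // i ≠ e}) : ℤ :=
  M (some w) i - M (some w) e * ε * c i

theorem sum_eliminate {A : Type*} [AddCommGroup A] (M : Option V → E → ℤ) (e : E) (ε : ℤ)
    (c : {i // i ≠ e} → ℤ) (w : V) (z : {i // i ≠ e} → A) :
    ∑ i, eliminate M e ε c w i • z i =
      ∑ i, M (some w) i.1 • z i - (M (some w) e * ε) • ∑ i, c i • z i := by
  simp only [eliminate, sub_smul, Finset.sum_sub_distrib, Finset.smul_sum, mul_smul]

/-- Eliminating a column whose pivot `± d` divides both its row and its column splits off a factor
consisting of the `d`-torsion. -/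
theorem card_integerSystemSolutions_option (M : Option V → E → ℤ) (e : E) (ε : ℤ)
    (c : {i // i ≠ e} → ℤ) (d : ℕ) (hε : ε * ε = 1) (h_pivot : M none e = d * ε)
    (h_row : ∀ i, M none i.1 = d * c i) (h_col : ∀ w, (d : ℤ) ∣ M (some w) e)
    (A : Type*) [AddCommGroup A] :
    Nat.card (integerSystemSolutions M A) =
      Nat.card {a : A // d • a = 0} *
        Nat.card (integerSystemSolutions (eliminate M e ε c) A) := by
  -- In the coordinate `y = ε x_e + ∑ c_i x_i`, row `none` says `d • y = 0`. Since `d` divides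
  -- column `e`, such a `y` drops out of the other rows once `x_e` is replaced by `ε (y - ∑ c_i
  -- x_i)`.
  have h_kill : ∀ (y : A) (w : V), d • y = 0 → M (some w) e • y = 0 := by
    intro y w hy
    obtain ⟨k, hk⟩ := h_col w
    rw [hk, mul_comm, mul_smul, natCast_zsmul, hy, smul_zero]
  have h_tors : ∀ x ∈ integerSystemSolutions M A,
      d • (ε • x e + ∑ i, c i • x i.1) = 0 := by
    intro x hx
    have := hx none
    rw [Fintype.sum_eq_add_sum_subtype_ne_of_decidable e] at this
    simpa only [h_pivot, h_row, mul_smul, ← Finset.smul_sum, ← smul_add, natCast_zsmul] using this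
  rw [← Nat.card_prod]
  refine Nat.card_congr
    { toFun := fun x => (⟨ε • x.1 e + ∑ i, c i • x.1 i.1, h_tors _ x.2⟩,
        ⟨fun i => x.1 i.1, fun w => ?_⟩)
      invFun := fun p => ⟨(Equiv.funSplitAt e A).symm (ε • (p.1.1 - ∑ i, c i • p.2.1 i), p.2.1),
        fun v => ?_⟩
      left_inv := fun x => ?_
      right_inv := fun p => ?_ }
  · rw [sum_eliminate]
    have h1 := x.2 (some w)
    rw [Fintype.sum_eq_add_sum_subtype_ne_of_decidable e] at h1
    have h2 := h_kill _ w (h_tors _ x.2)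
    rw [smul_add] at h2
    have h3 := congrArg (fun a => ε • a) h2
    simp only [smul_add, smul_zero, smul_smul] at h3
    rw [show ε * (M (some w) e * ε) = M (some w) e * (ε * ε) by ring, hε, mul_one,
      mul_comm ε] at h3
    rw [← sub_eq_zero.mpr (h1.trans h3.symm)]
    abel
  · obtain ⟨⟨y, hy⟩, ⟨z, hz⟩⟩ := p
    rw [Fintype.sum_eq_add_sum_subtype_ne_of_decidable e]
    have h_ne : ∀ i : {i // i ≠ e},
        (Equiv.funSplitAt e A).symm (ε • (y - ∑ i, c i • z i), z) i.1 = z i := by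
      intro i
      simp [Equiv.funSplitAt, Equiv.piSplitAt, i.2]
    simp only [h_ne]
    have h_eq : (Equiv.funSplitAt e A).symm (ε • (y - ∑ i, c i • z i), z) e =
        ε • (y - ∑ i, c i • z i) := by
      simp [Equiv.funSplitAt, Equiv.piSplitAt]
    rw [h_eq]
    cases v with
    | none =>
      simp only [h_pivot, h_row]
      rw [smul_smul, mul_assoc, hε, mul_one]
      simp only [mul_smul, ← Finset.smul_sum, ← smul_add]
      simpa using hy
    | some w =>
      have := hz w
      rw [sum_eliminate] at this
      have h2 := h_kill _ w hy
      rw [smul_smul, smul_sub, mul_comm (M (some w) e) ε, mul_smul ε _ y, h2, smul_zero,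
        mul_comm ε, zero_sub, add_comm, ← sub_eq_add_neg]
      exact this
  · apply Subtype.ext
    funext j
    by_cases h : j = e
    · subst h
      simp [Equiv.funSplitAt, Equiv.piSplitAt, smul_smul, hε]
    · simp [Equiv.funSplitAt, Equiv.piSplitAt, h]
  · obtain ⟨⟨y, hy⟩, ⟨z, hz⟩⟩ := p
    have h_ne : ∀ i : {i // i ≠ e},
        (Equiv.funSplitAt e A).symm (ε • (y - ∑ i, c i • z i), z) i.1 = z i := by
      intro i
      simp [Equiv.funSplitAt, Equiv.piSplitAt, i.2]
    have h_eq : (Equiv.funSplitAt e A).symm (ε • (y - ∑ i, c i • z i), z) e =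
        ε • (y - ∑ i, c i • z i) := by
      simp [Equiv.funSplitAt, Equiv.piSplitAt]
    simp only [h_ne, h_eq, smul_smul, hε, one_smul, sub_add_cancel]

end Pivot

/-- Every integer matrix with rows indexed by `V` and columns of `ℓ¹`-norm at most `2` has a number
of solutions over `A` that is a monomial in `|A|` and `|Tor₂ A|`. -/
def CountsAreMonomial.{u, w} (V : Type u) [Fintype V] : Prop :=
  ∀ (E : Type w) [Fintype E] (M : V → E → ℤ), (∀ e, ∑ v, |M v e| ≤ 2) →
    ∃ a b : ℕ, ∀ (A : Type) [AddCommGroup A] [Finite A],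
      Nat.card (integerSystemSolutions M A) =
        Nat.card A ^ a * Nat.card {a : A // 2 • a = 0} ^ b

theorem countsAreMonomial_of_equiv.{u, w} (V W : Type u) [Fintype W] (f : V ≃ W)
    (ih : @CountsAreMonomial.{u, w} V (Fintype.ofEquiv W f.symm)) : CountsAreMonomial.{u, w} W := by
  intro E _ M hM
  let _ : Fintype V := Fintype.ofEquiv W f.symm
  obtain ⟨a, b, h⟩ := ih E (fun v => M (f v)) fun e => by
    rw [Equiv.sum_comp f fun w => |M w e|]
    exact hM e
  refine ⟨a, b, fun A _ _ => ?_⟩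
  rw [← h A]
  congr 2
  ext x
  exact (f.forall_congr_left (p := fun v => ∑ e, M (f v) e • x e = 0)).trans 
    (by simp [integerSystemSolutions]) |>.symm

theorem countsAreMonomial_pempty.{u, w} : CountsAreMonomial.{u, w} PEmpty.{u + 1} := by
  intro E _ M _
  refine ⟨Fintype.card E, 0, fun A _ _ => ?_⟩
  have : integerSystemSolutions M A = Set.univ :=
    Set.eq_univ_of_forall fun x v => v.elim
  rw [this]
  simp [Nat.card_pi]

/-- With a pivot `±1`, the rest of its column has norm at most `1`, so elimination adds to column
`i` at most `|M none i|`, exactly what is lost with row `none`. If row `none` has no entry `±1` but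
some `±2`, the rest of that pivot's column is zero and the row is even, so `d = 2` applies.
Otherwise the row is zero. -/
theorem countsAreMonomial_option.{u, w} (V : Type u) [Fintype V] (ih : CountsAreMonomial.{u, w} V) :
    CountsAreMonomial.{u, w} (Option V) := by
  intro E _ M hM
  classical
  have hM' : ∀ e, |M none e| + ∑ v, |M (some v) e| ≤ 2 := fun e => by
    simpa only [Fintype.sum_option] using hM e
  have h_nonneg : ∀ e, 0 ≤ ∑ v, |M (some v) e| := fun e =>
    Finset.sum_nonneg fun _ _ => abs_nonneg _
  by_cases h1 : ∃ e, |M none e| = 1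
  · obtain ⟨e, he⟩ := h1
    have h_unit : |M none e| * |M none e| = 1 := by rw [he]; norm_num
    obtain ⟨a, b, h⟩ := ih _ (eliminate M e (M none e) fun i => M none i.1) fun i => by
      have : ∀ w, |eliminate M e (M none e) (fun i => M none i.1) w i| ≤
          |M (some w) i.1| + |M (some w) e| * |M none i.1| := by
        intro w
        refine (abs_sub _ _).trans ?_
        rw [abs_mul, abs_mul, he, mul_one]
      refine (Finset.sum_le_sum fun w _ => this w).trans ?_
      rw [Finset.sum_add_distrib, ← Finset.sum_mul]
      have h2 : ∑ w, |M (some w) e| ≤ 1 := by have := hM' e; omega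
      have := mul_le_mul_of_nonneg_right h2 (abs_nonneg (M none i.1))
      have := hM' i.1
      omega
    refine ⟨a, b, fun A _ _ => ?_⟩
    rw [card_integerSystemSolutions_option M e (M none e) (fun i => M none i.1) 1
      (by rw [← abs_mul_abs_self, h_unit]) (by simp) (by simp) (by simp), h A]
    simp
  · by_cases h2 : ∃ e, |M none e| = 2
    · obtain ⟨e, he⟩ := h2
      have h_col : ∀ w, M (some w) e = 0 := fun w => by
        have h3 := Finset.single_le_sum (f := fun v => |M (some v) e|)
          (fun _ _ => abs_nonneg _) (Finset.mem_univ w)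
        have h4 := hM' e
        exact abs_nonpos_iff.mp (by omega)
      have h_even : ∀ i, ∃ k, M none i = 2 * k := fun i => by
        have := hM' i
        have := h_nonneg i
        have : ¬ |M none i| = 1 := fun h => h1 ⟨i, h⟩
        have := abs_le.mp (show |M none i| ≤ 2 by omega)
        refine ⟨M none i / 2, ?_⟩
        rcases abs_cases (M none i) with h | h <;> omega
      choose k hk using h_even
      obtain ⟨a, b, h⟩ := ih _ (eliminate M e (k e) fun i => k i.1) fun i => by
        simp only [eliminate, h_col, zero_mul, sub_zero]
        have := hM' i.1
        have := abs_nonneg (M none i.1)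
        omega
      refine ⟨a, b + 1, fun A _ _ => ?_⟩
      have hε : k e * k e = 1 := by
        rw [hk e, abs_mul] at he
        rw [← abs_mul_abs_self, show |k e| = 1 by norm_num at he; omega]
        norm_num
      rw [card_integerSystemSolutions_option M e (k e) (fun i => k i.1) 2
        hε (by simpa using hk e) (by simpa using fun i _ => hk i) (by simp [h_col]), h A]
      ring
    · have h_zero : ∀ e, M none e = 0 := fun e => by
        have := hM' e
        have := h_nonneg e
        have : ¬ |M none e| = 1 := fun h => h1 ⟨e, h⟩
        have : ¬ |M none e| = 2 := fun h => h2 ⟨e, h⟩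
        have := abs_nonneg (M none e)
        exact abs_nonpos_iff.mp (by omega)
      obtain ⟨a, b, h⟩ := ih _ (fun v => M (some v)) fun e => by
        have := hM' e
        have := abs_nonneg (M none e)
        omega
      refine ⟨a, b, fun A _ _ => ?_⟩
      rw [← h A]
      congr 2
      ext x
      simp [integerSystemSolutions, Option.forall, h_zero]

theorem countsAreMonomial.{u, w} (V : Type u) [Fintype V] : CountsAreMonomial.{u, w} V :=
  Fintype.induction_empty_option (P := fun V _ => CountsAreMonomial.{u, w} V)
    countsAreMonomial_of_equiv countsAreMonomial_pempty countsAreMonomial_option V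

/-- Solutions that vanish on `t` are solutions of the system without the columns in `t`. -/
theorem card_integerSystemSolutions_vanishing {V E : Type*} [Fintype E] [DecidableEq E]
    (M : V → E → ℤ) (t : Finset E) (A : Type*) [AddCommGroup A] :
    Nat.card {x : integerSystemSolutions M A // ∀ e ∈ t, x.1 e = 0} =
      Nat.card (integerSystemSolutions (fun v (e : {e // e ∉ t}) => M v e) A) := by
  have h_sum : ∀ x : E → A, (∀ e ∈ t, x e = 0) → ∀ v,
      ∑ e, M v e • x e = ∑ e : {e // e ∉ t}, M v e • x e := by
    intro x hx v
    rw [← Fintype.sum_subtype_add_sum_subtype (fun e => e ∈ t), Finset.sum_eq_zero, zero_add]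
    intro e _
    rw [hx _ e.2, smul_zero]
  refine Nat.card_congr
    { toFun := fun x => ⟨fun e => x.1.1 e, fun v => ?_⟩
      invFun := fun z => ⟨⟨fun e => if h : e ∉ t then z.1 ⟨e, h⟩ else 0, fun v => ?_⟩, ?_⟩
      left_inv := fun x => ?_
      right_inv := fun z => ?_ }
  · rw [← h_sum _ x.2]
    exact x.1.2 v
  · rw [h_sum _ (by simp +contextual)]
    refine (Finset.sum_congr rfl fun e _ => ?_).trans (z.2 v)
    simp [e.2]
  · simp +contextual
  · apply Subtype.ext
    apply Subtype.ext
    funext e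
    by_cases h : e ∈ t
    · simp [h, x.2 e h]
    · simp [h]
  · apply Subtype.ext
    funext e
    simp [e.2]

theorem card_integerSystemSolutions_nowhere_zero {V E : Type*} [Fintype E] [DecidableEq E]
    (M : V → E → ℤ) (A : Type*) [AddCommGroup A] [Finite A] :
    (Nat.card {x : integerSystemSolutions M A // ∀ e, x.1 e ≠ 0} : ℤ) =
      ∑ t : Finset E, (-1) ^ t.card *
        (Nat.card (integerSystemSolutions (fun v (e : {e // e ∉ t}) => M v e) A) : ℤ) := by
  classical
  have := Fintype.ofFinite (integerSystemSolutions M A)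
  have key := Finset.inclusion_exclusion_card_inf_compl (Finset.univ : Finset E)
    (fun e => Finset.univ.filter fun x : integerSystemSolutions M A => x.1 e = 0)
  rw [Finset.powerset_univ] at key
  simp only [← card_integerSystemSolutions_vanishing]
  convert key using 2
  · rw [Nat.card_eq_fintype_card, Fintype.card_subtype]
    congr 1
    ext x
    simp [Finset.mem_inf]
  · rw [Nat.card_eq_fintype_card, Fintype.card_subtype]
    congr 2
    refine congrArg Finset.card ?_
    ext x
    simp [Finset.mem_inf]

end IntegerMatrices

/-! ### Two-torsion counts and uniqueness of the polynomials. -/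

theorem ZMod.card_two_torsion (n : ℕ) [NeZero n] :
    Nat.card {a : ZMod n // 2 • a = 0} = n.gcd 2 := by
  have := IsAddCyclic.card_nsmulAddMonoidHom_ker (G := ZMod n) 2
  rw [Nat.card_zmod] at this
  exact this

/-- For fixed `k` these groups have infinitely many orders but the same two-torsion count. -/
theorem card_two_torsion_pi_prod (k m : ℕ) :
    Nat.card {a : (Fin k → ZMod 2) × ZMod (2 * m + 1) // 2 • a = 0} = 2 ^ k := by
  have h_odd : Nat.gcd (2 * m + 1) 2 = 1 := by simp
  have h_zero := ZMod.card_two_torsion (2 * m + 1)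
  rw [h_odd, Nat.card_eq_one_iff_unique] at h_zero
  have h_iff : ∀ a : (Fin k → ZMod 2) × ZMod (2 * m + 1), 2 • a = 0 ↔ a.2 = 0 := by
    intro a
    refine ⟨fun h => ?_, fun h => ?_⟩
    · exact congrArg Subtype.val (h_zero.1.elim ⟨a.2, congrArg Prod.snd h⟩ ⟨0, smul_zero _⟩)
    · refine Prod.ext (funext fun i => ?_) (by simp [h])
      exact (two_nsmul _).trans (CharTwo.add_self_eq_zero (a.1 i))
  calc Nat.card {a : (Fin k → ZMod 2) × ZMod (2 * m + 1) // 2 • a = 0}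
    _ = Nat.card (Fin k → ZMod 2) := Nat.card_congr
        { toFun := fun a => a.1.1
          invFun := fun x => ⟨(x, 0), (h_iff _).mpr rfl⟩
          left_inv := fun a => Subtype.ext (Prod.ext rfl ((h_iff _).mp a.2).symm)
          right_inv := fun _ => rfl }
    _ = 2 ^ k := by simp

section Uniqueness

variable {R : Type*} [CommRing R] [IsDomain R] [CharZero R]

theorem Polynomial.eq_of_eval_natCast_eq {p q : R[X]} (f : ℕ → ℕ) (hf : Function.Injective f)
    (h : ∀ m, p.eval (f m : R) = q.eval (f m : R)) : p = q := by
  refine eq_of_infinite_eval_eq p q (Set.Infinite.mono ?_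
    (Set.infinite_range_of_injective (Nat.cast_injective.comp hf : Function.Injective _)))
  rintro _ ⟨m, rfl⟩
  exact h m

/-- A bivariate polynomial is determined by its values at the pairs `(|A|, |Tor₂ A|)`. -/
theorem Polynomial.Bivariate.eq_of_evalEval_card_eq {φ ψ : R[X][Y]}
    (h : ∀ (A : Type) [AddCommGroup A] [Finite A],
      φ.evalEval (Nat.card A : R) (Nat.card {a : A // 2 • a = 0} : R) =
        ψ.evalEval (Nat.card A : R) (Nat.card {a : A // 2 • a = 0} : R)) : φ = ψ := by
  have h_pow : ∀ k : ℕ, φ.eval (C ((2 ^ k : ℕ) : R)) = ψ.eval (C ((2 ^ k : ℕ) : R)) := by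
    intro k
    refine eq_of_eval_natCast_eq (fun m => 2 ^ k * (2 * m + 1)) (fun a b hab => ?_) fun m => ?_
    · simpa using hab
    · have := h ((Fin k → ZMod 2) × ZMod (2 * m + 1))
      rw [card_two_torsion_pi_prod] at this
      simpa [evalEval] using this
  -- The same interpolation argument, now in `t` over the coefficient domain `R[X]`.
  refine eq_of_eval_natCast_eq (fun k => 2 ^ k) (Nat.pow_right_injective le_rfl) fun k => ?_
  simpa only [map_natCast] using h_pow k

end Uniqueness

/-! ### Flows as solutions of the incidence system. -/

namespace SignedGraph

variable {V E : Type*} (S : SignedGraph V E)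

/-- Each of the two ends contributes `±1` at no more than one vertex; the contributions cancel at a
positive loop. -/
theorem sum_abs_incidence_le [Fintype V] (a : S.Arc) : ∑ v, |S.incidence v a| ≤ 2 := by
  classical
  have h : ∀ v, |S.incidence v a| ≤ ∑ i, if S.ends a.edge i = some v then 1 else 0 := by
    intro v
    unfold incidence
    refine (Finset.abs_sum_le_sum_abs _ _).trans (Finset.sum_le_sum fun i _ => ?_)
    split_ifs <;> simp [Int.isUnit_iff_abs_eq.mp (a.arrow i).isUnit]
  refine (Finset.sum_le_sum fun v _ => h v).trans ?_
  rw [Finset.sum_comm]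
  have h_end : ∀ i : Fin 2, (∑ v, if S.ends a.edge i = some v then (1 : ℤ) else 0) ≤ 1 := by
    intro i
    cases S.ends a.edge i <;> simp
  exact (Finset.sum_le_sum fun i _ => h_end i).trans (by simp)

theorem Arc.reverse_ne {S : SignedGraph V E} (a : S.Arc) : a.reverse ≠ a := fun h => by
  have := congrFun (congrArg Arc.arrow h) 0
  revert this
  change -a.arrow 0 = a.arrow 0 → False
  generalize a.arrow 0 = u
  revert u
  decide

theorem Arc.reverse_reverse {S : SignedGraph V E} (a : S.Arc) : a.reverse.reverse = a :=
  Arc.ext rfl (funext fun _ => neg_neg _)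

/-- A chain is determined by its values on the reference arcs, which are arbitrary. -/
noncomputable def chainEquiv (A : Type*) [AddCommGroup A] : S.chainGroup A ≃ (E → A) := by
  classical
  exact
  { toFun := fun c e => c.1 (S.refArc e)
    invFun := fun x => ⟨fun a => if a = S.refArc a.edge then x a.edge else -x a.edge, fun a => by
      change (if a.reverse = S.refArc a.edge then x a.edge else -x a.edge) =
        -(if a = S.refArc a.edge then x a.edge else -x a.edge)
      rcases a.eq_or_eq_reverse (S.refArc a.edge) rfl with h | h
      · have h' : a.reverse ≠ S.refArc a.edge := fun h' => a.reverse_ne (h'.trans h.symm)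
        rw [if_neg h', if_pos h]
      · have h1 : a.reverse = S.refArc a.edge :=
          (congrArg Arc.reverse h).trans (Arc.reverse_reverse _)
        have h' : a ≠ S.refArc a.edge := fun h' => a.reverse_ne (h1.trans h'.symm)
        rw [if_pos h1, if_neg h', neg_neg]⟩
    left_inv := fun c => Subtype.ext (funext fun a => by
      change (if a = S.refArc a.edge then c.1 (S.refArc a.edge) else -c.1 (S.refArc a.edge)) = _
      split_ifs with h
      · rw [← h]
      · have h1 := (a.eq_or_eq_reverse (S.refArc a.edge) rfl).resolve_left h
        rw [← c.2, ← h1])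
    right_inv := fun x => funext fun e => if_pos rfl }

theorem chainEquiv_apply (A : Type*) [AddCommGroup A] (c : S.chainGroup A) (e : E) :
    S.chainEquiv A c e = c.1 (S.refArc e) := rfl

end SignedGraph

namespace SignedGraph

variable {V E : Type*} (S : SignedGraph V E)

/-- Nowhere-zero flows are the nowhere-zero solutions of the incidence system. -/
theorem numNowhereZeroFlows_eq_card [Fintype E] (A : Type*) [AddCommGroup A] :
    S.numNowhereZeroFlows A =
      Nat.card {x : integerSystemSolutions (fun v e => S.incidence v (S.refArc e)) A //
        ∀ e, x.1 e ≠ 0} := by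
  refine Nat.card_congr (((S.chainEquiv A).subtypeEquiv
    (q := fun x => x ∈ integerSystemSolutions (fun v e => S.incidence v (S.refArc e)) A ∧
      ∀ e, x e ≠ 0) fun c => and_congr funext_iff ⟨fun h e => h _, fun h a => ?_⟩).trans
    (Equiv.subtypeSubtypeEquivSubtypeInter _ _).symm)
  have h_ref := h a.edge
  rw [chainEquiv_apply] at h_ref
  rcases a.eq_or_eq_reverse (S.refArc a.edge) rfl with h' | h'
  · rwa [h']
  · rw [h', c.2]
    exact neg_ne_zero.mpr h_ref

theorem exists_isFlowPolynomial [Finite V] [Fintype E] (R : Type*) [CommRing R] :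
    ∃ φ : R[X][Y], S.IsFlowPolynomial φ := by
  classical
  have := Fintype.ofFinite V
  have h_mono : ∀ t : Finset E, ∃ a b : ℕ, ∀ (A : Type) [AddCommGroup A] [Finite A],
      Nat.card (integerSystemSolutions
        (fun v (e : {e // e ∉ t}) => S.incidence v (S.refArc e)) A) =
        Nat.card A ^ a * Nat.card {a : A // 2 • a = 0} ^ b := fun t =>
    countsAreMonomial V _ _ fun e => S.sum_abs_incidence_le _
  choose a b h using h_mono
  -- The `X` under `C` is the inner variable, standing for `|A|`; the other is the outer one,
  -- standing for `|Tor₂ A|`.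
  refine ⟨∑ t : Finset E, (-1) ^ t.card * (C (X ^ a t) * X ^ b t), fun A _ _ => ?_⟩
  have key := card_integerSystemSolutions_nowhere_zero
    (fun v e => S.incidence v (S.refArc e)) A
  rw [← numNowhereZeroFlows_eq_card] at key
  have key' := congrArg (Int.cast : ℤ → R) key
  simpa [evalEval_finsetSum, h, evalEval_C] using key'

theorem IsFlowPolynomial.eval_natCast {S : SignedGraph V E} [Fintype E] {R : Type*} [CommRing R]
    {φ : R[X][Y]} (hφ : S.IsFlowPolynomial φ) (n : ℕ) (hn : n ≠ 0) :
    (φ.eval (C ((n.gcd 2 : ℕ) : R))).eval (n : R) = (S.numNowhereZeroFlows (ZMod n) : R) := by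
  have : NeZero n := ⟨hn⟩
  rw [hφ (ZMod n), Nat.card_zmod, ZMod.card_two_torsion, evalEval]

end SignedGraph

theorem mainTheorem7 {V E : Type*} [Finite V] [Fintype E] [Nonempty E]
    (S : SignedGraph V E)
    {R : Type*} [CommRing R] [IsDomain R] [CharZero R] :
    ∃ φ : R[X][Y],
      (S.IsFlowPolynomial φ ∧ ∀ ψ : R[X][Y], S.IsFlowPolynomial ψ → ψ = φ) ∧
      ∃ φeven φodd : R[X],
        (S.CountsEvenFlows φeven ∧ ∀ p : R[X], S.CountsEvenFlows p → p = φeven) ∧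
        (S.CountsOddFlows φodd ∧ ∀ p : R[X], S.CountsOddFlows p → p = φodd) ∧
        φeven = φ.eval (C 2) ∧
        φodd = φ.eval (C 1) := by
  obtain ⟨φ, hφ⟩ := S.exists_isFlowPolynomial R
  have h_even : S.CountsEvenFlows (φ.eval (C 2)) := fun n hn h => by
    have := hφ.eval_natCast n (by omega)
    rwa [Nat.gcd_eq_right h.two_dvd, Nat.cast_ofNat] at this
  have h_odd : S.CountsOddFlows (φ.eval (C 1)) := fun n hn h => by
    have := hφ.eval_natCast n (by omega)
    rwa [Nat.coprime_two_right.mpr h, Nat.cast_one] at this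
  refine ⟨φ, ⟨hφ, fun ψ hψ => Polynomial.Bivariate.eq_of_evalEval_card_eq fun A _ _ =>
    (hψ A).symm.trans (hφ A)⟩, _, _, ⟨h_even, fun p hp => ?_⟩, ⟨h_odd, fun p hp => ?_⟩, rfl, rfl⟩
  -- The shift `m + 1` keeps the sample points in the range `n ≥ 2`, here and in the odd case.
  · refine eq_of_eval_natCast_eq (fun m => 2 * (m + 1)) (fun a b h => by simpa using h) fun m => ?_
    exact (hp _ (by omega) (even_two_mul _)).trans (h_even _ (by omega) (even_two_mul _)).symm
  · refine eq_of_eval_natCast_eq (fun m => 2 * (m + 1) + 1) (fun a b h => by simpa using h)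
      fun m => ?_
    exact (hp _ (by omega) (odd_two_mul_add_one _)).trans
      (h_odd _ (by omega) (odd_two_mul_add_one _)).symm
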